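/- Let $r\ge 1$ be an integer, $h=1/(r+1)$, $\alpha_0,\dots,\alpha_r\in\mathbb C\setminus\{0\}$, $\beta_0,\dots,\beta_r\in\mathbb C$, and \[ \alpha=\sum_{j=0}^r\alpha_j\,\mathbf 1_{(jh,(j+1)h]},\qquad \beta=\sum_{j=0}^r\beta_j\,\mathbf 1_{(jh,(j+1)h]} . \] Let $D_\alpha$ be the operator in the complex space $L_2(0,1)$ with domain $\{u\in H_0^1(0,1): -(\alpha u')'\in L_2(0,1)\}$ (derivatives in the distributional sense) and $D_\alpha u=-(\alpha u')'$. Let $D_\alpha+\beta$ be the operator $u\mapsto-(\alpha u')'+\beta u$ on the domain of $D_\alpha$; it is called continuously invertible if it maps its domain bijectively onto $L_2(0,1)$ with bounded inverse. For $j\in\{0,\dots,r\}$ let $A^{(j)}=(a^{(j)}_{kl})_{k,l\in\{0,1\}}\in\mathbb C^{2\times2}$ be the transition matrix with respect to $(h,\beta_j/\alpha_j)$, that is, the unique matrix with \[ A^{(j)}\begin{pmatrix}u(0)\\u'(0)\end{pmatrix}=\begin{pmatrix}u(h)\\u'(h)\end{pmatrix} \quad\text{for every solution } u \text{ of } u''=\tfrac{\beta_j}{\alpha_j}u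 \text{ on } [0,h], \] and let \[ \tilde A_{\alpha_j}=\begin{pmatrix}1&0\\0&\alpha_j\end{pmatrix}A^{(j)}\begin{pmatrix}1&0\\0&\alpha_j^{-1}\end{pmatrix}. \] The characteristic function of $(\alpha,\beta)$ is \[ p_{\alpha,\beta}=\begin{pmatrix}a^{(r)}_{00}&\alpha_r^{-1}a^{(r)}_{01}\end{pmatrix}\tilde A_{\alpha_{r-1}}\cdots\tilde A_{\alpha_1}\begin{pmatrix}a^{(0)}_{01}\\ \alpha_0a^{(0)}_{11}\end{pmatrix} \] (for $r=1$ the product of the matrices $\tilde A_{\alpha_j}$ is empty, i.e. the identity matrix). Assume $\mathfrak m(\alpha^{-1})=\int_0^1\alpha(x)^{-1}\,\mathrm dx\ne0$. Then the following conditions are equivalent: (i) $D_\alpha+\beta$ is continuously invertible in $L_2(0,1)$; (ii) $D_\alpha+\beta$ is one-to-one; (iii) $p_{\alpha,\beta}\ne0$. -/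

import Mathlib

open MeasureTheory Set
open scoped ENNReal ContDiff Matrix

namespace IndefSL

/-! ### The function spaces on `(0,1)` -/

/-- Lebesgue measure on the open interval `(0,1)`. -/
noncomputable abbrev mu : Measure ℝ := volume.restrict (Ioo (0 : ℝ) 1)

/-- The complex Hilbert space `L_2(0,1)`. -/
abbrev L2 : Type := Lp ℂ 2 mu

/-- The space `L_∞(0,1)`. -/
abbrev LInf : Type := Lp ℂ ∞ mu

/-- Complex-valued test functions: `φ ∈ C_c^∞(0,1)`, extended by zero to `ℝ`. -/
structure IsTest (φ : ℝ → ℂ) : Prop where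
  smooth : ContDiff ℝ ∞ φ
  compact : HasCompactSupport φ
  supp : tsupport φ ⊆ Ioo (0 : ℝ) 1

/-- `v` is the distributional derivative of `u` on `(0,1)`. -/
def HasWeakDeriv (u v : L2) : Prop :=
  ∀ φ : ℝ → ℂ, IsTest φ →
    ∫ x in Ioo (0 : ℝ) 1, u x * deriv φ x = -∫ x in Ioo (0 : ℝ) 1, v x * φ x

theorem IsTest.zero : IsTest (fun _ => 0) :=
  ⟨contDiff_const, HasCompactSupport.zero, by simp [tsupport]⟩

theorem IsTest.add {φ ψ : ℝ → ℂ} (hφ : IsTest φ) (hψ : IsTest ψ) :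
    IsTest (fun x => φ x + ψ x) :=
  ⟨hφ.smooth.add hψ.smooth, hφ.compact.add hψ.compact,
    (tsupport_add φ ψ).trans (union_subset hφ.supp hψ.supp)⟩

theorem IsTest.const_mul {φ : ℝ → ℂ} (c : ℂ) (hφ : IsTest φ) : IsTest (fun x => c * φ x) :=
  ⟨contDiff_const.mul hφ.smooth, hφ.compact.mul_left,
    (tsupport_mul_subset_right (f := fun _ => c)).trans hφ.supp⟩

theorem IsTest.deriv {φ : ℝ → ℂ} (hφ : IsTest φ) : IsTest (deriv φ) :=
  ⟨(contDiff_infty_iff_deriv.1 hφ.smooth).2, hφ.compact.deriv,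
    (tsupport_deriv_subset).trans hφ.supp⟩

theorem integrable_mul_test (u : L2) {φ : ℝ → ℂ} (hφ : IsTest φ) :
    Integrable (fun x => u x * φ x) mu := by
  have h1 : Integrable u mu := (Lp.memLp u).integrable (by norm_num)
  obtain ⟨C, hC⟩ := hφ.compact.exists_bound_of_continuous hφ.smooth.continuous
  exact h1.mul_bdd hφ.smooth.continuous.aestronglyMeasurable (.of_forall hC)

theorem HasWeakDeriv.zero : HasWeakDeriv 0 0 := by
  intro φ _
  have h : ∀ ψ : ℝ → ℂ, ∫ x in Ioo (0 : ℝ) 1, (0 : L2) x * ψ x = 0 := fun ψ => by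
    rw [← integral_zero ℝ ℂ (μ := mu)]
    refine integral_congr_ae ?_
    filter_upwards [Lp.coeFn_zero ℂ 2 mu] with x hx
    rw [hx, Pi.zero_apply, zero_mul]
  rw [h, h, neg_zero]

theorem HasWeakDeriv.add {u v u' v' : L2} (h : HasWeakDeriv u v) (h' : HasWeakDeriv u' v') :
    HasWeakDeriv (u + u') (v + v') := by
  have key : ∀ (a b : L2) (ψ : ℝ → ℂ), IsTest ψ → ∫ x in Ioo (0 : ℝ) 1, (a + b : L2) x * ψ x =
      (∫ x in Ioo (0 : ℝ) 1, a x * ψ x) + ∫ x in Ioo (0 : ℝ) 1, b x * ψ x := fun a b ψ hψ => by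
    rw [← integral_add (integrable_mul_test a hψ) (integrable_mul_test b hψ)]
    refine integral_congr_ae ?_
    filter_upwards [Lp.coeFn_add a b] with x hx
    rw [hx, Pi.add_apply, add_mul]
  intro φ hφ
  rw [key _ _ _ hφ.deriv, key _ _ _ hφ, h φ hφ, h' φ hφ]
  ring

theorem HasWeakDeriv.smul {u v : L2} (c : ℂ) (h : HasWeakDeriv u v) :
    HasWeakDeriv (c • u) (c • v) := by
  have key : ∀ (a : L2) (ψ : ℝ → ℂ), ∫ x in Ioo (0 : ℝ) 1, (c • a : L2) x * ψ x =
      c * ∫ x in Ioo (0 : ℝ) 1, a x * ψ x := fun a ψ => by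
    rw [← integral_const_mul]
    refine integral_congr_ae ?_
    filter_upwards [Lp.coeFn_smul c a] with x hx
    rw [hx, Pi.smul_apply, smul_eq_mul, mul_assoc]
  intro φ hφ
  rw [key, key, h φ hφ, mul_neg]

/-- The graph of the distributional derivative in `L_2(0,1)`; its domain is `H^1(0,1)`. -/
def weakDerivGraph : Submodule ℂ (L2 × L2) where
  carrier := {p | HasWeakDeriv p.1 p.2}
  zero_mem' := HasWeakDeriv.zero
  add_mem' h h' := HasWeakDeriv.add h h'
  smul_mem' c _ h := HasWeakDeriv.smul c h

/-- The pairs `(φ, φ')` in `L_2(0,1) × L_2(0,1)` with `φ ∈ C_c^∞(0,1)`. -/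
def testGraph : Submodule ℂ (L2 × L2) where
  carrier := {p | ∃ φ : ℝ → ℂ, IsTest φ ∧ p.1 =ᵐ[mu] φ ∧ p.2 =ᵐ[mu] deriv φ}
  zero_mem' := by
    refine ⟨fun _ => 0, IsTest.zero, Lp.coeFn_zero ℂ 2 mu, ?_⟩
    have : deriv (fun _ : ℝ => (0 : ℂ)) = 0 := by ext x; simp
    rw [this]
    exact Lp.coeFn_zero ℂ 2 mu
  add_mem' := by
    rintro p q ⟨φ, hφ, h1, h2⟩ ⟨ψ, hψ, h3, h4⟩
    refine ⟨_, hφ.add hψ, ?_, ?_⟩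
    · filter_upwards [h1, h3, Lp.coeFn_add p.1 q.1] with x a b c
      rw [Prod.fst_add, c, Pi.add_apply, a, b]
    · filter_upwards [h2, h4, Lp.coeFn_add p.2 q.2] with x a b c
      rw [Prod.snd_add, c, Pi.add_apply, a, b]
      exact (deriv_fun_add (hφ.smooth.differentiable (by simp) x)
        (hψ.smooth.differentiable (by simp) x)).symm
  smul_mem' := by
    rintro c p ⟨φ, hφ, h1, h2⟩
    refine ⟨_, hφ.const_mul c, ?_, ?_⟩
    · filter_upwards [h1, Lp.coeFn_smul c p.1] with x a b
      rw [Prod.smul_fst, b, Pi.smul_apply, a, smul_eq_mul]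
    · filter_upwards [h2, Lp.coeFn_smul c p.2] with x a b
      rw [Prod.smul_snd, b, Pi.smul_apply, a, smul_eq_mul]
      exact (deriv_const_mul c (hφ.smooth.differentiable (by simp) x)).symm

/-- The pairs `(u, u')` with `u ∈ H_0^1(0,1)`, the closure of `C_c^∞(0,1)` in `H^1(0,1)`
(convergence in `H^1` is convergence of `u` and `u'` in `L_2`). -/
noncomputable def h01Graph : Submodule ℂ (L2 × L2) :=
  weakDerivGraph ⊓ testGraph.topologicalClosure

/-! ### The operators -/

/-- The multiplication operator on `L_2(0,1)` induced by an `L_∞` function. -/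
noncomputable def mulOp (a : LInf) : L2 →L[ℂ] L2 :=
  (ContinuousLinearMap.mul ℂ ℂ).holderL mu ∞ 2 2 a

theorem mulOp_coeFn (a : LInf) (u : L2) : mulOp a u =ᵐ[mu] fun x => a x * u x :=
  (ContinuousLinearMap.mul ℂ ℂ).coeFn_holder a u

/-- The graph of `D_α`: the pairs `(u, f)` of `L_2` functions such that `u ∈ H_0^1(0,1)` and
`-(α u')' = f` in the distributional sense. -/
noncomputable def dGraph (a : LInf) : Submodule ℂ (L2 × L2) where
  carrier := {p | ∃ v : L2, (p.1, v) ∈ h01Graph ∧ HasWeakDeriv (mulOp a v) (-p.2)}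
  zero_mem' := ⟨0, h01Graph.zero_mem, by simpa using HasWeakDeriv.zero⟩
  add_mem' := by
    rintro p q ⟨v, hv, hf⟩ ⟨w, hw, hg⟩
    refine ⟨v + w, h01Graph.add_mem hv hw, ?_⟩
    have := hf.add hg
    rwa [← map_add, ← neg_add] at this
  smul_mem' := by
    rintro c p ⟨v, hv, hf⟩
    refine ⟨c • v, h01Graph.smul_mem c hv, ?_⟩
    have := hf.smul c
    rwa [← map_smul, smul_neg] at this

/-- `D_α = -(α u')'`, the `L_2(0,1)`-realisation with maximal domain contained in `H_0^1(0,1)`. -/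
noncomputable def opD (a : LInf) : L2 →ₗ.[ℂ] L2 := (dGraph a).toLinearPMap

/-- The distributional derivative is unique. -/
theorem HasWeakDeriv.eq_zero {v : L2} (h : HasWeakDeriv 0 v) : v = 0 := by
  have hv : LocallyIntegrableOn v (Ioo (0 : ℝ) 1) volume :=
    IntegrableOn.locallyIntegrableOn ((Lp.memLp v).integrable (by norm_num))
  have h0 := isOpen_Ioo.ae_eq_zero_of_integral_contDiff_smul_eq_zero hv (fun g hg hc hs => by
    have hT : IsTest (fun x => (g x : ℂ)) :=
      ⟨Complex.ofRealCLM.contDiff.comp hg, hc.comp_left (g := Complex.ofReal) rfl,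
        (closure_mono (Function.support_comp_subset (g := Complex.ofReal) rfl g)).trans hs⟩
    have h1 := h _ hT
    have h2 : ∫ x in Ioo (0 : ℝ) 1, (0 : L2) x * deriv (fun x => (g x : ℂ)) x = 0 := by
      rw [← integral_zero ℝ ℂ (μ := mu)]
      refine integral_congr_ae ?_
      filter_upwards [Lp.coeFn_zero ℂ 2 mu] with x hx
      rw [hx, Pi.zero_apply, zero_mul]
    rw [h2, eq_comm, neg_eq_zero] at h1
    rw [← h1, ← setIntegral_eq_integral_of_forall_compl_eq_zero (s := Ioo (0 : ℝ) 1)]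
    · refine integral_congr_ae (.of_forall fun x => ?_)
      simp [mul_comm]
    · intro x hx
      have : g x = 0 := by
        by_contra hne
        exact hx (hs (subset_tsupport g hne))
      simp [this])
  refine Lp.ext ?_
  have h3 : ∀ᵐ x ∂mu, v x = 0 := by
    rw [ae_restrict_iff' measurableSet_Ioo]
    exact h0
  filter_upwards [h3, Lp.coeFn_zero ℂ 2 mu] with x a b
  rw [a, b, Pi.zero_apply]

theorem dGraph_single (a : LInf) (p : L2 × L2) (hp : p ∈ dGraph a) (h0 : p.1 = 0) : p.2 = 0 := by
  obtain ⟨v, hv, hf⟩ := hp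
  rw [h0] at hv
  have hv0 : v = 0 := HasWeakDeriv.eq_zero hv.1
  rw [hv0, map_zero] at hf
  exact neg_eq_zero.1 hf.eq_zero

/-- `D_α` has the intended graph. -/
theorem opD_graph (a : LInf) : (opD a).graph = dGraph a :=
  Submodule.toLinearPMap_graph_eq _ (dGraph_single a)

/-- `D_α + β`, with the domain of `D_α`. -/
noncomputable def opSL (a b : LInf) : L2 →ₗ.[ℂ] L2 where
  domain := (opD a).domain
  toFun := (opD a).toFun + (mulOp b).toLinearMap ∘ₗ (opD a).domain.subtype

/-- `T` is continuously invertible: it is a bijection of its domain onto the whole space, with a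
bounded inverse `B`. -/
def ContinuouslyInvertible (T : L2 →ₗ.[ℂ] L2) : Prop :=
  ∃ B : L2 →L[ℂ] L2, (∀ f : L2, ∃ hf : B f ∈ T.domain, T ⟨B f, hf⟩ = f) ∧
    ∀ u : T.domain, B (T u) = u

/-! ### Piecewise constant coefficients -/

/-- The function `∑_{j=0}^r a_j 1_{(jh,(j+1)h]}` with `h = 1/(r+1)`. -/
noncomputable def pwFun (r : ℕ) (a : Fin (r + 1) → ℂ) (x : ℝ) : ℂ :=
  ∑ j : Fin (r + 1),
    (Ioc (((j : ℕ) : ℝ) * (1 / ((r : ℝ) + 1))) ((((j : ℕ) : ℝ) + 1) * (1 / ((r : ℝ) + 1)))).indicator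
      (fun _ => a j) x

theorem memLp_pwFun (r : ℕ) (a : Fin (r + 1) → ℂ) : MemLp (pwFun r a) ∞ mu :=
  memLp_finsetSum _ fun j _ => (memLp_const (a j)).indicator measurableSet_Ioc

/-- The piecewise constant function as an element of `L_∞(0,1)`. -/
noncomputable def pw (r : ℕ) (a : Fin (r + 1) → ℂ) : LInf := (memLp_pwFun r a).toLp

/-- The integral mean on `(0,1)`. -/
noncomputable def mean (g : ℝ → ℂ) : ℂ := ∫ x in Ioo (0 : ℝ) 1, g x

/-! ### Transition matrices and the characteristic function -/

/-- `u` solves `u'' = τ u` on `[0,h]`, and `w = u'`. -/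
def IsSolution (h : ℝ) (τ : ℂ) (u w : ℝ → ℂ) : Prop :=
  ∀ x ∈ Icc 0 h, HasDerivWithinAt u (w x) (Icc 0 h) x ∧
    HasDerivWithinAt w (τ * u x) (Icc 0 h) x

/-- `A` is the transition matrix with respect to `(h, τ)`: it maps `(u(0), u'(0))` to
`(u(h), u'(h))` for every solution of `u'' = τ u`. -/
def IsTransitionMatrix (h : ℝ) (τ : ℂ) (A : Matrix (Fin 2) (Fin 2) ℂ) : Prop :=
  ∀ u w : ℝ → ℂ, IsSolution h τ u w → A *ᵥ ![u 0, w 0] = ![u h, w h]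

theorem exists_fundamental (τ : ℂ) : ∃ c s : ℝ → ℂ, c 0 = 1 ∧ s 0 = 0 ∧
    (∀ x, HasDerivAt c (τ * s x) x) ∧ ∀ x, HasDerivAt s (c x) x := by
  by_cases hτ : τ = 0
  · refine ⟨fun _ => 1, fun x => (x : ℂ), rfl, by simp, fun x => ?_, fun x => ?_⟩
    · simpa [hτ] using hasDerivAt_const x (1 : ℂ)
    · exact Complex.ofRealCLM.hasDerivAt
  · obtain ⟨m, hm⟩ := IsAlgClosed.exists_eq_mul_self τ
    have hm0 : m ≠ 0 := by rintro rfl; simp [hm] at hτ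
    have hl : ∀ x : ℝ, HasDerivAt (fun x : ℝ => m * (x : ℂ)) m x := fun x => by
      simpa using (Complex.ofRealCLM.hasDerivAt (x := x)).const_mul m
    refine ⟨fun x => Complex.cosh (m * x), fun x => Complex.sinh (m * x) / m, by simp, by simp,
      fun x => ?_, fun x => ?_⟩
    · have := (Complex.hasDerivAt_cosh (m * x)).comp x (hl x)
      convert! this using 1
      rw [hm]; field_simp
    · have := ((Complex.hasDerivAt_sinh (m * x)).comp x (hl x)).div_const m
      convert! this using 1
      field_simp

theorem existsUnique_transitionMatrix {h : ℝ} (hh : 0 < h) (τ : ℂ) :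
    ∃! A, IsTransitionMatrix h τ A := by
  obtain ⟨c, s, hc0, hs0, hc, hs⟩ := exists_fundamental τ
  have hsol : IsSolution h τ c (fun x => τ * s x) := fun x _ =>
    ⟨(hc x).hasDerivWithinAt, ((hs x).const_mul τ).hasDerivWithinAt⟩
  have hsol' : IsSolution h τ s c := fun x _ =>
    ⟨(hs x).hasDerivWithinAt, (hc x).hasDerivWithinAt⟩
  refine ⟨!![c h, s h; τ * s h, c h], ?_, ?_⟩
  · intro u w huw
    have hsub : ∀ x : ℝ, HasDerivAt (fun x : ℝ => h - x) (-1) x := fun x => by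
      simpa using (hasDerivAt_id x).const_sub h
    have hcr : ∀ x : ℝ, HasDerivAt (fun x => c (h - x)) (-(τ * s (h - x))) x := fun x => by
      simpa [Function.comp_def] using (hc (h - x)).scomp x (hsub x)
    have hsr : ∀ x : ℝ, HasDerivAt (fun x => s (h - x)) (-c (h - x)) x := fun x => by
      simpa [Function.comp_def] using (hs (h - x)).scomp x (hsub x)
    have hconst : ∀ F : ℝ → ℂ, (∀ x ∈ Icc 0 h, HasDerivWithinAt F 0 (Icc 0 h) x) → F 0 = F h := by
      intro F hF
      refine ((convex_Icc 0 h).is_const_of_fderivWithin_eq_zero (𝕜 := ℝ)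
        (fun x hx => (hF x hx).differentiableWithinAt) (fun x hx => ?_)
        (left_mem_Icc.2 hh.le) (right_mem_Icc.2 hh.le))
      ext
      simpa [fderivWithin_derivWithin] using (hF x hx).derivWithin (uniqueDiffOn_Icc hh x hx)
    have e1 := hconst (fun x => c (h - x) * u x + s (h - x) * w x) (fun x hx => by
      convert! ((hcr x).hasDerivWithinAt.mul (huw x hx).1).add
        ((hsr x).hasDerivWithinAt.mul (huw x hx).2) using 1
      ring)
    have e2 := hconst (fun x => τ * s (h - x) * u x + c (h - x) * w x) (fun x hx => by
      convert! ((((hsr x).const_mul τ).hasDerivWithinAt).mul (huw x hx).1).add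
        ((hcr x).hasDerivWithinAt.mul (huw x hx).2) using 1
      ring)
    simp only [sub_zero, sub_self, hc0, hs0] at e1 e2
    ext i
    fin_cases i
    · simpa [Matrix.mulVec, dotProduct, Fin.sum_univ_two] using e1
    · simpa [Matrix.mulVec, dotProduct, Fin.sum_univ_two] using e2
  · intro A hA
    have e1 := hA _ _ hsol
    have e2 := hA _ _ hsol'
    simp only [hc0, hs0] at e1 e2
    have a1 := congrFun e1 0
    have a2 := congrFun e1 1
    have a3 := congrFun e2 0
    have a4 := congrFun e2 1
    simp [Matrix.mulVec, dotProduct, Fin.sum_univ_two] at a1 a2 a3 a4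
    ext i j
    fin_cases i <;> fin_cases j <;> simp [a1, a2, a3, a4]

/-- The transition matrix with respect to `(h, τ)`, for `h > 0`. -/
noncomputable def transitionMatrix (h : ℝ) (τ : ℂ) : Matrix (Fin 2) (Fin 2) ℂ :=
  Classical.epsilon (IsTransitionMatrix h τ)

theorem transitionMatrix_spec {h : ℝ} (hh : 0 < h) (τ : ℂ) :
    IsTransitionMatrix h τ (transitionMatrix h τ) :=
  Classical.epsilon_spec (existsUnique_transitionMatrix hh τ).exists

/-- `A^{(j)}`, the transition matrix with respect to `(1/(r+1), β_j/α_j)`. -/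
noncomputable def slabMatrix (r : ℕ) (a b : Fin (r + 1) → ℂ) (j : Fin (r + 1)) :
    Matrix (Fin 2) (Fin 2) ℂ :=
  transitionMatrix (1 / ((r : ℝ) + 1)) (b j / a j)

/-- `diag(1, α_j) A^{(j)} diag(1, α_j^{-1})`. -/
noncomputable def slabMatrixTilde (r : ℕ) (a b : Fin (r + 1) → ℂ) (j : Fin (r + 1)) :
    Matrix (Fin 2) (Fin 2) ℂ :=
  !![1, 0; 0, a j] * slabMatrix r a b j * !![1, 0; 0, (a j)⁻¹]

/-- The characteristic function of `(α, β)` (for `r ≥ 1`):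
`(a_{00}^{(r)}, α_r^{-1} a_{01}^{(r)}) Ã_{r-1} ⋯ Ã_1 (a_{01}^{(0)}, α_0 a_{11}^{(0)})ᵀ`;
the factor with list index `k` is `Ã_{r-1-k}`, `k = 0, …, r-2`. -/
noncomputable def characteristicFun (r : ℕ) (a b : Fin (r + 1) → ℂ) : ℂ :=
  ![slabMatrix r a b (Fin.last r) 0 0, (a (Fin.last r))⁻¹ * slabMatrix r a b (Fin.last r) 0 1] ⬝ᵥ
    ((List.ofFn fun k : Fin (r - 1) =>
        slabMatrixTilde r a b ⟨r - 1 - (k : ℕ), by omega⟩).prod *ᵥ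
      ![slabMatrix r a b 0 0 1, a 0 * slabMatrix r a b 0 1 1])

end IndefSL

namespace IndefSL

/-! ### The Volterra operator -/

/-! Put `w = α u'`. Then `(D_α + β) u = g` becomes the first-order system `u' = α⁻¹ w`, `w' = β u -
g` with `u(0) = u(1) = 0`. With `V` the Volterra operator and `c = w(0)`, this reads `u = V α⁻¹ (c +
V (β u - g))`, together with the vanishing at `1` of that primitive (`mem_graph_opSL_iff`). It rests
on two facts: `HasWeakDeriv u v` means `u = c + V v` (`hasWeakDeriv_iff`), and `H_0^1` consists of
the primitives `V v` with `∫ v = 0` (`mem_h01Graph_iff`).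

The powers of `K = V α⁻¹ V β` decay factorially, so `1 - K` is invertible and `u` is determined by
`c` and `g`. Only the condition at `1` remains, a scalar equation `c * shotEnd = particularEnd g`
(`mem_graph_opSL_iff_shot`). If `shotEnd ≠ 0` it gives a bounded inverse; if `shotEnd = 0` the
nonzero function `shot` lies in the kernel.

For piecewise constant coefficients the pair `(u, α u')` is continuous across the interfaces and is
carried over slab `j` by `slabMatrixTilde`. Multiplying the slabs together gives `p = α_0 * shotEnd`
(`characteristicFun_eq`), and `α_0 ≠ 0`. -/

theorem integrable_L2 (f : L2) : Integrable f mu := (Lp.memLp f).integrable (by norm_num)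

theorem norm_setIntegral_le (f : L2) (s : Set ℝ) : ‖∫ t in s, f t ∂mu‖ ≤ ‖f‖ := by
  have h1 : ‖∫ t in s, f t ∂mu‖ ≤ ∫ t, ‖f t‖ ∂mu :=
    (norm_integral_le_integral_norm _).trans
      (setIntegral_le_integral (integrable_L2 f).norm (.of_forall fun _ => norm_nonneg _))
  refine h1.trans ?_
  rw [integral_norm_eq_lintegral_enorm (Lp.aestronglyMeasurable f), ← eLpNorm_one_eq_lintegral_enorm,
    Lp.norm_def]
  have : IsProbabilityMeasure mu := ⟨by simp⟩
  exact ENNReal.toReal_mono (Lp.eLpNorm_ne_top f)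
    (eLpNorm_le_eLpNorm_of_exponent_le (by norm_num) (Lp.aestronglyMeasurable f))

/-- The primitive of `f` vanishing at `0`. -/
noncomputable def prim (f : L2) (x : ℝ) : ℂ := ∫ t in Iic x, f t ∂mu

theorem prim_add (f g : L2) (x : ℝ) : prim (f + g) x = prim f x + prim g x := by
  rw [prim, prim, prim, ← integral_add (integrable_L2 f).restrict (integrable_L2 g).restrict]
  exact integral_congr_ae (ae_restrict_of_ae (Lp.coeFn_add f g))

theorem prim_smul (c : ℂ) (f : L2) (x : ℝ) : prim (c • f) x = c * prim f x := by
  rw [prim, prim, ← integral_const_mul]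
  exact integral_congr_ae (ae_restrict_of_ae (Lp.coeFn_smul c f))

theorem norm_prim_le (f : L2) (x : ℝ) : ‖prim f x‖ ≤ ‖f‖ := norm_setIntegral_le f _

theorem prim_of_nonpos (f : L2) {x : ℝ} (hx : x ≤ 0) : prim f x = 0 := by
  rw [prim, Measure.restrict_restrict measurableSet_Iic, show Iic x ∩ Ioo 0 1 = ∅ by
    ext y; simp only [mem_inter_iff, mem_Iic, mem_Ioo, mem_empty_iff_false]; grind]
  simp

theorem prim_sub_prim (f : L2) (x y : ℝ) : prim f y - prim f x = ∫ t in x..y, f t ∂mu :=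
  intervalIntegral.integral_Iic_sub_Iic (integrable_L2 f).integrableOn
    (integrable_L2 f).integrableOn

theorem intervalIntegral_mu (F : ℝ → ℂ) {x y : ℝ} (hx : 0 ≤ x) (hxy : x ≤ y) (hy : y ≤ 1) :
    ∫ t in x..y, F t ∂mu = ∫ t in x..y, F t := by
  rw [intervalIntegral.integral_of_le hxy, intervalIntegral.integral_of_le hxy,
    Measure.restrict_restrict measurableSet_Ioc, integral_Ioc_eq_integral_Ioo]
  refine setIntegral_congr_set ?_
  have h : Ioo x y ⊆ Ioc x y ∩ Ioo 0 1 := fun t ht =>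
    ⟨Ioo_subset_Ioc_self ht, hx.trans_lt ht.1, ht.2.trans_le hy⟩
  have h' : (Ioc x y ∩ Ioo 0 1 : Set ℝ) ≤ᵐ[volume] Ioc x y :=
    LE.le.eventuallyLE inter_subset_left
  exact (h'.trans Ioo_ae_eq_Ioc.symm.le).antisymm h.eventuallyLE

theorem continuous_prim (f : L2) : Continuous (prim f) := by
  have h : prim f = fun x => ∫ t in (0 : ℝ)..x, f t ∂mu := by
    ext x
    rw [← prim_sub_prim, prim_of_nonpos f le_rfl, sub_zero]
  rw [h]
  exact intervalIntegral.continuous_primitive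
    (fun _ _ => (integrable_L2 f).intervalIntegrable) 0

theorem memLp_prim (f : L2) : MemLp (prim f) 2 mu :=
  MemLp.of_bound (continuous_prim f).aestronglyMeasurable ‖f‖ (.of_forall (norm_prim_le f))

/-- The Volterra operator `f ↦ ∫_0^x f`. -/
noncomputable def volterra : L2 →L[ℂ] L2 :=
  LinearMap.mkContinuous
    { toFun := fun f => (memLp_prim f).toLp
      map_add' := fun f g => by
        rw [← MemLp.toLp_add]
        exact MemLp.toLp_congr _ _ (.of_forall (prim_add f g))
      map_smul' := fun c f => by
        rw [RingHom.id_apply, ← MemLp.toLp_const_smul]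
        exact MemLp.toLp_congr _ _ (.of_forall (prim_smul c f)) } 1 fun f => by
    have h := Lp.norm_le_of_ae_bound (f := (memLp_prim f).toLp) (norm_nonneg f) (by
      filter_upwards [(memLp_prim f).coeFn_toLp] with x hx
      rw [hx]
      exact norm_prim_le f x)
    simpa [measureUnivNNReal] using h

theorem volterra_coeFn (f : L2) : volterra f =ᵐ[mu] prim f := (memLp_prim f).coeFn_toLp

/-- The integral over `(0,1)`. -/
noncomputable def integralL : L2 →L[ℂ] ℂ :=
  LinearMap.mkContinuous
    { toFun := fun f => prim f 1
      map_add' := fun f g => prim_add f g 1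
      map_smul' := fun c f => prim_smul c f 1 } 1 fun f => by
    simpa using norm_prim_le f 1

theorem integralL_apply (f : L2) : integralL f = prim f 1 := rfl

theorem integralL_eq (f : L2) : integralL f = ∫ t in Ioo (0 : ℝ) 1, f t := by
  rw [integralL_apply, prim, Measure.restrict_restrict measurableSet_Iic,
    show Iic (1 : ℝ) ∩ Ioo 0 1 = Ioo 0 1 from inter_eq_right.2 fun t ht => ht.2.le]

/-- The constant function `1`. -/
noncomputable def one : L2 := (memLp_const (1 : ℂ)).toLp (fun _ => 1)

theorem one_coeFn : one =ᵐ[mu] fun _ => 1 := MemLp.coeFn_toLp _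

/-! ### Test functions -/

theorem IsTest.eq_zero {φ : ℝ → ℂ} (hφ : IsTest φ) {x : ℝ} (hx : x ∉ Ioo (0 : ℝ) 1) : φ x = 0 :=
  image_eq_zero_of_notMem_tsupport fun h => hx (hφ.supp h)

theorem IsTest.integral_deriv {φ : ℝ → ℂ} (hφ : IsTest φ) (x y : ℝ) :
    ∫ t in x..y, _root_.deriv φ t = φ y - φ x :=
  intervalIntegral.integral_deriv_eq_sub
    (fun t _ => hφ.smooth.differentiable (by simp) t)
    (hφ.deriv.smooth.continuous.intervalIntegrable _ _)

theorem IsTest.memLp {φ : ℝ → ℂ} (hφ : IsTest φ) : MemLp φ 2 mu :=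
  (hφ.smooth.continuous.memLp_of_hasCompactSupport hφ.compact).restrict _

theorem hasWeakDeriv_one : HasWeakDeriv one 0 := by
  intro φ hφ
  have h1 : ∫ x in Ioo (0 : ℝ) 1, one x * deriv φ x = ∫ x in Ioo (0 : ℝ) 1, deriv φ x :=
    integral_congr_ae (by filter_upwards [one_coeFn] with x hx; rw [hx, one_mul])
  have h2 : ∫ x in Ioo (0 : ℝ) 1, (0 : L2) x * φ x = ∫ x in Ioo (0 : ℝ) 1, (0 : ℂ) :=
    integral_congr_ae (by
      filter_upwards [Lp.coeFn_zero ℂ 2 mu] with x hx; rw [hx, Pi.zero_apply, zero_mul])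
  rw [h1, h2, ← integral_Ioc_eq_integral_Ioo, ← intervalIntegral.integral_of_le zero_le_one,
    hφ.integral_deriv, hφ.eq_zero (by simp), hφ.eq_zero (by simp)]
  simp

/-- Fubini on the triangle `t ≤ x`: integrating `deriv φ` over `[t, 1)` leaves `-φ t`. -/
theorem hasWeakDeriv_volterra (v : L2) : HasWeakDeriv (volterra v) v := by
  intro φ hφ
  have hφi : Integrable (deriv φ) mu := hφ.deriv.memLp.integrable (by norm_num)
  let S : Set (ℝ × ℝ) := {p | p.2 ≤ p.1}
  have hS : MeasurableSet S := measurableSet_le measurable_snd measurable_fst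
  let F : ℝ → ℝ → ℂ := fun x t => S.indicator (fun p => deriv φ p.1 * v p.2) (x, t)
  have hF : Integrable (Function.uncurry F) (mu.prod mu) :=
    (hφi.mul_prod (integrable_L2 v)).indicator hS
  have h1 : ∫ x in Ioo (0 : ℝ) 1, volterra v x * deriv φ x = ∫ x, ∫ t, F x t ∂mu ∂mu := by
    refine integral_congr_ae ?_
    filter_upwards [volterra_coeFn v] with x hx
    have : F x = (Iic x).indicator fun t => deriv φ x * v t := by
      ext t
      by_cases h : t ≤ x <;> simp [F, S, h]
    rw [hx, this, integral_indicator measurableSet_Iic, integral_const_mul, prim, mul_comm]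
  rw [h1, integral_integral_swap hF, ← integral_neg]
  refine setIntegral_congr_fun measurableSet_Ioo fun t ht => ?_
  have : (fun x => F x t) = (Ici t).indicator fun x => deriv φ x * v t := by
    ext x
    by_cases h : t ≤ x <;> simp [F, S, h]
  have h2 : Ici t ∩ Ioo 0 1 = Ico t 1 := by
    ext y; simp only [mem_inter_iff, mem_Ici, mem_Ioo, mem_Ico]; grind
  rw [this, integral_indicator measurableSet_Ici, integral_mul_const,
    Measure.restrict_restrict measurableSet_Ici, h2, integral_Ico_eq_integral_Ioc,
    ← intervalIntegral.integral_of_le ht.2.le, hφ.integral_deriv,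
    hφ.eq_zero (x := 1) (by simp)]
  ring

/-! ### Weak derivatives and primitives -/

theorem exists_isTest_integral_eq_one :
    ∃ η : ℝ → ℂ, IsTest η ∧ ∫ x in Ioo (0 : ℝ) 1, η x = 1 := by
  let f : ContDiffBump (1 / 2 : ℝ) := ⟨1 / 8, 1 / 4, by norm_num, by norm_num⟩
  have ht : tsupport (f.normed volume) ⊆ Ioo (0 : ℝ) 1 := by
    rw [f.tsupport_normed_eq]
    intro x hx
    have h2 : |x - 1 / 2| ≤ 1 / 4 := hx
    rw [abs_le] at h2
    constructor <;> linarith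
  refine ⟨fun x => (f.normed volume x : ℂ), ⟨Complex.ofRealCLM.contDiff.comp f.contDiff_normed,
    f.hasCompactSupport_normed.comp_left (g := Complex.ofReal) rfl,
    (closure_mono (Function.support_comp_subset (g := Complex.ofReal) rfl _)).trans ht⟩, ?_⟩
  rw [integral_complex_ofReal, setIntegral_eq_integral_of_forall_compl_eq_zero, f.integral_normed,
    Complex.ofReal_one]
  exact fun x hx => image_eq_zero_of_notMem_tsupport fun h => hx (ht h)

theorem IsTest.exists_primitive {φ : ℝ → ℂ} (hφ : IsTest φ)
    (h0 : ∫ x in Ioo (0 : ℝ) 1, φ x = 0) : ∃ Φ, IsTest Φ ∧ _root_.deriv Φ = φ := by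
  have hc : Continuous φ := hφ.smooth.continuous
  have hd : ∀ x, HasDerivAt (fun x => ∫ t in (0 : ℝ)..x, φ t) (φ x) x := fun x =>
    (hc.integral_hasStrictDerivAt 0 x).hasDerivAt
  have hd' : _root_.deriv (fun x => ∫ t in (0 : ℝ)..x, φ t) = φ := funext fun x => (hd x).deriv
  -- The point `1/2` keeps `K` nonempty when `φ = 0`. The primitive vanishes left of `sInf K`
  -- because `φ` does, and right of `sSup K` because the total integral is zero.
  let K : Set ℝ := insert (1 / 2) (tsupport φ)
  have hK : IsCompact K := hφ.compact.isCompact.insert _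
  have hKn : K.Nonempty := ⟨1 / 2, mem_insert _ _⟩
  have hK1 : K ⊆ Ioo 0 1 := insert_subset (by norm_num) hφ.supp
  have hz : ∀ t ∉ K, φ t = 0 := fun t ht =>
    image_eq_zero_of_notMem_tsupport fun h => ht (mem_insert_of_mem _ h)
  have ha := hK1 (hK.sInf_mem hKn)
  have hb := hK1 (hK.sSup_mem hKn)
  have hs : Function.support (fun x => ∫ t in (0 : ℝ)..x, φ t) ⊆ Icc (sInf K) (sSup K) := by
    intro x hx
    by_contra hn
    apply hx
    rcases lt_or_ge x (sInf K) with h | h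
    · refine intervalIntegral.integral_zero_ae (.of_forall fun t ht => hz t fun htK => ?_)
      exact absurd (csInf_le hK.bddBelow htK) (not_le.2 (ht.2.trans_lt (max_lt ha.1 h)))
    · have h' : sSup K < x := not_le.1 fun h'' => hn ⟨h, h''⟩
      have e1 : ∫ t in (0 : ℝ)..1, φ t = 0 := by
        rw [intervalIntegral.integral_of_le zero_le_one, integral_Ioc_eq_integral_Ioo, h0]
      have e2 : ∫ t in x..1, φ t = 0 := by
        refine intervalIntegral.integral_zero_ae (.of_forall fun t ht => hz t fun htK => ?_)
        exact absurd (le_csSup hK.bddAbove htK) (not_le.2 ((lt_min h' hb.2).trans ht.1))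
      rw [← e1, ← intervalIntegral.integral_add_adjacent_intervals
        (hc.intervalIntegrable 0 x) (hc.intervalIntegrable x 1), e2, add_zero]
  have hts : tsupport (fun x => ∫ t in (0 : ℝ)..x, φ t) ⊆ Icc (sInf K) (sSup K) :=
    closure_minimal hs isClosed_Icc
  refine ⟨_, ⟨?_, .of_support_subset_isCompact isCompact_Icc hs,
    hts.trans (Icc_subset_Ioo ha.1 hb.2)⟩, hd'⟩
  rw [contDiff_infty_iff_deriv, hd']
  exact ⟨fun x => (hd x).differentiableAt, hφ.smooth⟩

theorem HasWeakDeriv.neg {u v : L2} (h : HasWeakDeriv u v) : HasWeakDeriv (-u) (-v) := by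
  simpa using h.smul (-1)

/-- A function with vanishing distributional derivative is constant. -/
theorem HasWeakDeriv.exists_eq_smul_one {u : L2} (h : HasWeakDeriv u 0) :
    ∃ c : ℂ, u = c • one := by
  obtain ⟨η, hη, hη1⟩ := exists_isTest_integral_eq_one
  let c : ℂ := ∫ x in Ioo (0 : ℝ) 1, u x * η x
  refine ⟨c, sub_eq_zero.1 (HasWeakDeriv.eq_zero fun φ hφ => ?_)⟩
  have hz : ∀ ψ : ℝ → ℂ, ∫ x in Ioo (0 : ℝ) 1, (0 : L2) x * ψ x = 0 := fun ψ =>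
    integral_eq_zero_of_ae (by
      filter_upwards [Lp.coeFn_zero ℂ 2 mu] with x hx; rw [hx]; simp)
  have hφi : Integrable φ mu := hφ.memLp.integrable (by norm_num)
  have hηi : Integrable η mu := hη.memLp.integrable (by norm_num)
  let m : ℂ := ∫ x in Ioo (0 : ℝ) 1, φ x
  -- Du Bois-Reymond: subtracting `m` times `η` makes the mean zero, so the difference is the
  -- derivative of a test function and `u` annihilates it.
  obtain ⟨Φ, hΦ, hΦd⟩ := (hφ.add (hη.const_mul (-m))).exists_primitive (by
    rw [integral_add hφi (hηi.const_mul _), integral_const_mul, hη1]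
    simp [m])
  have h1 := h Φ hΦ
  rw [hΦd, hz, neg_zero] at h1
  have h2 : ∫ x in Ioo (0 : ℝ) 1, u x * (φ x + -m * η x) =
      (∫ x in Ioo (0 : ℝ) 1, u x * φ x) - m * c := by
    have : ∀ x, u x * (φ x + -m * η x) = u x * φ x - m * (u x * η x) := fun x => by ring
    simp_rw [this]
    rw [integral_sub (integrable_mul_test u hφ) ((integrable_mul_test u hη).const_mul _),
      integral_const_mul]
  have h3 : ∫ x in Ioo (0 : ℝ) 1, (u - c • one : L2) x * φ x =
      (∫ x in Ioo (0 : ℝ) 1, u x * φ x) - c * m := by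
    rw [← integral_const_mul, ← integral_sub (integrable_mul_test u hφ) (hφi.const_mul _)]
    refine integral_congr_ae ?_
    filter_upwards [Lp.coeFn_sub u (c • one), Lp.coeFn_smul c one, one_coeFn] with x e1 e2 e3
    rw [e1, Pi.sub_apply, e2, Pi.smul_apply, e3, smul_eq_mul]
    ring
  rw [hz, h3, eq_comm, neg_eq_zero, ← h1, h2, mul_comm c]

theorem hasWeakDeriv_iff {u v : L2} :
    HasWeakDeriv u v ↔ ∃ c : ℂ, u = c • one + volterra v := by
  constructor
  · intro h
    obtain ⟨c, hc⟩ := HasWeakDeriv.exists_eq_smul_one (u := u - volterra v) (by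
      simpa [sub_eq_add_neg] using h.add (hasWeakDeriv_volterra v).neg)
    exact ⟨c, sub_eq_iff_eq_add.1 hc⟩
  · rintro ⟨c, rfl⟩
    simpa using (hasWeakDeriv_one.smul c).add (hasWeakDeriv_volterra v)

theorem eq_zero_of_volterra_eq_zero {v : L2} (h : volterra v = 0) : v = 0 :=
  HasWeakDeriv.eq_zero (h ▸ hasWeakDeriv_volterra v)

/-! ### The space `H_0^1(0,1)` -/

theorem testGraph_primitive {p : L2 × L2} (hp : p ∈ testGraph) :
    p.1 = volterra p.2 ∧ integralL p.2 = 0 := by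
  obtain ⟨φ, hφ, h1, h2⟩ := hp
  have key : ∀ x ∈ Icc (0 : ℝ) 1, prim p.2 x = φ x := fun x hx => by
    rw [← sub_zero (prim p.2 x), ← prim_of_nonpos p.2 le_rfl, prim_sub_prim,
      intervalIntegral.integral_congr_ae_restrict (g := deriv φ) (ae_restrict_of_ae h2),
      intervalIntegral_mu _ le_rfl hx.1 hx.2, hφ.integral_deriv, hφ.eq_zero (x := 0) (by simp),
      sub_zero]
  constructor
  · refine Lp.ext ?_
    filter_upwards [h1, volterra_coeFn p.2, ae_restrict_mem measurableSet_Ioo] with x e1 e2 hx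
    rw [e1, e2, key x (Ioo_subset_Icc_self hx)]
  · rw [integralL_apply, key 1 (by simp), hφ.eq_zero (by simp)]

/-- Double orthogonal complement: if `g` is orthogonal to every `φ'`, then its conjugate has zero
weak derivative and is a constant `c`, so `⟨g, v⟩ = c ∫ v = 0`. -/
theorem mem_closure_test_derivs {v : L2} (hv : integralL v = 0) :
    v ∈ (testGraph.map (LinearMap.snd ℂ L2 L2)).topologicalClosure := by
  rw [← Submodule.orthogonal_orthogonal_eq_closure, Submodule.mem_orthogonal]
  intro g hg
  have hin : ∀ p : L2, inner ℂ g p = ∫ x in Ioo (0 : ℝ) 1, (star g : L2) x * p x := fun p => by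
    rw [L2.inner_def]
    refine integral_congr_ae ?_
    filter_upwards [Lp.coeFn_star g] with x hx
    rw [hx, RCLike.inner_apply, mul_comm]
    rfl
  obtain ⟨c, hc⟩ := HasWeakDeriv.exists_eq_smul_one (u := star g) (fun φ hφ => by
    have h0 : ∫ x in Ioo (0 : ℝ) 1, (0 : L2) x * φ x = 0 := integral_eq_zero_of_ae (by
      filter_upwards [Lp.coeFn_zero ℂ 2 mu] with x hx; rw [hx]; simp)
    have h1 : inner ℂ g (hφ.deriv.memLp.toLp) = 0 :=
      (Submodule.mem_orthogonal' _ _).1 hg _ ⟨(hφ.memLp.toLp, hφ.deriv.memLp.toLp),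
        ⟨φ, hφ, hφ.memLp.coeFn_toLp, hφ.deriv.memLp.coeFn_toLp⟩, rfl⟩
    rw [h0, neg_zero, ← h1, hin]
    refine integral_congr_ae ?_
    filter_upwards [hφ.deriv.memLp.coeFn_toLp] with x hx
    rw [hx])
  rw [hin, hc, ← mul_zero c, ← hv, integralL_eq, ← integral_const_mul]
  refine integral_congr_ae ?_
  filter_upwards [Lp.coeFn_smul c one, one_coeFn] with x e1 e2
  rw [e1, Pi.smul_apply, e2, smul_eq_mul, mul_one]

/-- Both conditions on the right are closed and hold for test functions. Conversely, `v` is a limit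
of derivatives of test functions, and `w ↦ (volterra w, w)` is continuous. -/
theorem mem_h01Graph_iff {u v : L2} :
    (u, v) ∈ h01Graph ↔ u = volterra v ∧ integralL v = 0 := by
  constructor
  · rintro ⟨-, h⟩
    let S : Submodule ℂ (L2 × L2) :=
      LinearMap.ker ((ContinuousLinearMap.fst ℂ L2 L2 -
        volterra ∘L ContinuousLinearMap.snd ℂ L2 L2).prod
          (integralL ∘L ContinuousLinearMap.snd ℂ L2 L2)).toLinearMap
    have hS : ∀ p, p ∈ S ↔ p.1 = volterra p.2 ∧ integralL p.2 = 0 := fun p => by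
      simp [S, sub_eq_zero]
    have hSc : IsClosed (S : Set (L2 × L2)) := ContinuousLinearMap.isClosed_ker _
    exact (hS _).1 (Submodule.topologicalClosure_minimal _
      (fun p hp => (hS p).2 (testGraph_primitive hp)) hSc h)
  · rintro ⟨rfl, hv⟩
    refine ⟨hasWeakDeriv_volterra v, ?_⟩
    refine map_mem_closure (f := fun w : L2 => (volterra w, w)) (by fun_prop)
      (mem_closure_test_derivs hv) ?_
    rintro _ ⟨p, hp, rfl⟩
    have : (volterra p.2, p.2) = p := Prod.ext (testGraph_primitive hp).1.symm rfl
    exact this ▸ hp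

/-! ### The graph of the operator -/

theorem mem_graph_opSL {a b : LInf} {u g : L2} :
    (u, g) ∈ (opSL a b).graph ↔ (u, g - mulOp b u) ∈ dGraph a := by
  rw [← opD_graph, LinearPMap.mem_graph_iff, LinearPMap.mem_graph_iff]
  constructor
  · rintro ⟨y, hy, h⟩
    refine ⟨y, hy, ?_⟩
    simp only at hy h ⊢
    rw [← h, ← hy]
    exact (add_sub_cancel_right (opD a y) _).symm
  · rintro ⟨y, hy, h⟩
    refine ⟨y, hy, ?_⟩
    simp only at hy h
    rw [← hy, eq_sub_iff_add_eq] at h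
    exact h

/-- `u ∈ dom(D_α)` and `(D_α + β) u = g`, written as a system of integral equations. -/
theorem mem_graph_opSL_iff {a a' b : LInf} (h1 : mulOp a ∘L mulOp a' = 1)
    (h2 : mulOp a' ∘L mulOp a = 1) {u g : L2} :
    (u, g) ∈ (opSL a b).graph ↔ ∃ c : ℂ,
      u = volterra (mulOp a' (c • one + volterra (mulOp b u - g))) ∧
      integralL (mulOp a' (c • one + volterra (mulOp b u - g))) = 0 := by
  rw [mem_graph_opSL]
  constructor
  · rintro ⟨v, hv, hw⟩
    -- The integration constant `c` is the value of `α u'` at `0`.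
    obtain ⟨c, hc⟩ := hasWeakDeriv_iff.1 hw
    simp only [neg_sub] at hc
    obtain ⟨e1, e2⟩ := mem_h01Graph_iff.1 hv
    have e : v = mulOp a' (c • one + volterra (mulOp b u - g)) := by
      rw [← hc]
      exact (DFunLike.congr_fun h2 v).symm
    exact ⟨c, e ▸ e1, e ▸ e2⟩
  · rintro ⟨c, e1, e2⟩
    refine ⟨_, mem_h01Graph_iff.2 ⟨e1, e2⟩, hasWeakDeriv_iff.2 ⟨c, ?_⟩⟩
    rw [neg_sub]
    exact DFunLike.congr_fun h1 _

/-! ### Invertibility of Volterra perturbations of the identity -/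

theorem norm_mulOp_ae_le (a : LInf) (f : L2) : ∀ᵐ x ∂mu, ‖mulOp a f x‖ ≤ ‖a‖ * ‖f x‖ := by
  have h : ∀ᵐ x ∂mu, ‖a x‖ ≤ ‖a‖ := by
    have h1 := ae_le_eLpNormEssSup (f := a) (μ := mu)
    filter_upwards [h1] with x hx
    rw [Lp.norm_def, eLpNorm_exponent_top, ← toReal_enorm]
    exact ENNReal.toReal_mono (by
      rw [← eLpNorm_exponent_top]; exact Lp.eLpNorm_ne_top a) hx
  filter_upwards [h, mulOp_coeFn a f] with x h1 h2
  rw [h2, norm_mul]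
  gcongr

/-- Induction step for the factorial decay: integrating `t ^ n / n!` from `0` to `x` raises `n` by
one. -/
theorem norm_volterra_mulOp_ae_le (a : LInf) {f : L2} {M : ℝ} {n : ℕ}
    (hf : ∀ᵐ x ∂mu, ‖f x‖ ≤ M * (x ^ n / n.factorial)) :
    ∀ᵐ x ∂mu, ‖volterra (mulOp a f) x‖ ≤ ‖a‖ * M * (x ^ (n + 1) / (n + 1).factorial) := by
  filter_upwards [volterra_coeFn (mulOp a f), ae_restrict_mem measurableSet_Ioo] with x hx hx1
  have hpt : ∀ᵐ t ∂mu, ‖mulOp a f t‖ ≤ ‖a‖ * (M * (t ^ n / n.factorial)) := by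
    filter_upwards [norm_mulOp_ae_le a f, hf] with t h1 h2
    exact h1.trans (by gcongr)
  have hset : Iic x ∩ Ioo 0 1 = Ioc 0 x := by
    ext y; simp only [mem_inter_iff, mem_Iic, mem_Ioo, mem_Ioc]; grind
  have hc : Continuous fun t : ℝ => ‖a‖ * (M * (t ^ n / n.factorial)) := by fun_prop
  rw [hx, prim]
  refine (norm_integral_le_of_norm_le (g := fun t : ℝ => ‖a‖ * (M * (t ^ n / n.factorial))) ?_
    (ae_restrict_of_ae hpt)).trans_eq ?_
  · rw [Measure.restrict_restrict measurableSet_Iic, hset]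
    exact (hc.integrableOn_Icc (a := 0) (b := x)).mono_set Ioc_subset_Icc_self
  · rw [Measure.restrict_restrict measurableSet_Iic, hset,
      ← intervalIntegral.integral_of_le hx1.1.le, intervalIntegral.integral_const_mul,
      intervalIntegral.integral_const_mul, intervalIntegral.integral_div, integral_pow,
      Nat.factorial_succ]
    have : ((n : ℝ) + 1) ≠ 0 := by positivity
    push_cast
    field_simp
    simp

/-- The operator `u ↦ ∫_0^x a ∫_0^t b u`. -/
noncomputable def iteratedVolterra (a b : LInf) : L2 →L[ℂ] L2 :=
  volterra ∘L mulOp a ∘L volterra ∘L mulOp b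

/-- One application turns an `L_2` function into a bounded one, which starts the pointwise
induction. -/
theorem norm_iteratedVolterra_ae_le (a b : LInf) (f : L2) :
    ∀ᵐ x ∂mu, ‖iteratedVolterra a b f x‖ ≤ ‖mulOp a ∘L volterra ∘L mulOp b‖ * ‖f‖ := by
  filter_upwards [volterra_coeFn ((mulOp a ∘L volterra ∘L mulOp b) f)] with x hx
  exact (congrArg norm hx).le.trans ((norm_prim_le _ x).trans (ContinuousLinearMap.le_opNorm _ f))

theorem norm_iteratedVolterra_pow_ae_le (a b : LInf) {f : L2} {M : ℝ}
    (hf : ∀ᵐ x ∂mu, ‖f x‖ ≤ M) (k : ℕ) :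
    ∀ᵐ x ∂mu, ‖(iteratedVolterra a b ^ k) f x‖ ≤
      (‖a‖ * ‖b‖) ^ k * M * (x ^ (2 * k) / (2 * k).factorial) := by
  induction k with
  | zero => simpa using hf
  | succ k ih =>
    filter_upwards [norm_volterra_mulOp_ae_le a (norm_volterra_mulOp_ae_le b ih)] with x hx
    rw [pow_succ']
    refine hx.trans_eq ?_
    rw [show 2 * (k + 1) = 2 * k + 1 + 1 by ring]
    ring

/-- The extra factor in the power `k + 1` pays for passing from the `L_2` norm to a pointwise bound.
Weakening `(2k)!` to `k!` leaves the terms of an exponential series, which makes the Neumann series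
converge. -/
theorem norm_iteratedVolterra_pow_le (a b : LInf) (k : ℕ) :
    ‖iteratedVolterra a b ^ (k + 1)‖ ≤
      ‖mulOp a ∘L volterra ∘L mulOp b‖ * ((‖a‖ * ‖b‖) ^ k / k.factorial) := by
  refine ContinuousLinearMap.opNorm_le_bound _ (by positivity) fun f => ?_
  have h := norm_iteratedVolterra_pow_ae_le a b (norm_iteratedVolterra_ae_le a b f) k
  have h' := Lp.norm_le_of_ae_bound (f := (iteratedVolterra a b ^ (k + 1)) f)
    (C := ‖mulOp a ∘L volterra ∘L mulOp b‖ * ((‖a‖ * ‖b‖) ^ k / k.factorial) * ‖f‖)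
    (by positivity) (by
      filter_upwards [h, ae_restrict_mem measurableSet_Ioo] with x hx hx1
      rw [pow_succ]
      refine hx.trans ?_
      have h1 : x ^ (2 * k) / (2 * k).factorial ≤ 1 / (k.factorial : ℝ) := by
        gcongr
        · exact pow_le_one₀ hx1.1.le hx1.2.le
        · omega
      calc _ ≤ (‖a‖ * ‖b‖) ^ k * (‖mulOp a ∘L volterra ∘L mulOp b‖ * ‖f‖) *
            (1 / (k.factorial : ℝ)) := by gcongr
        _ = _ := by ring)
  simpa [measureUnivNNReal] using h'

theorem isUnit_one_sub_iteratedVolterra (a b : LInf) : IsUnit (1 - iteratedVolterra a b) := by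
  have hs : Summable fun n => iteratedVolterra a b ^ n := by
    rw [← summable_nat_add_iff 1]
    exact .of_norm_bounded ((Real.summable_pow_div_factorial _).mul_left _)
      (norm_iteratedVolterra_pow_le a b)
  exact ⟨⟨_, _, hs.one_sub_mul_tsum_pow, hs.tsum_pow_mul_one_sub⟩, rfl⟩

/-! ### Reduction to one initial value problem -/

/-- The solution `u` of `-(α u')' + β u = 0`, `u(0) = 0`, `(α u')(0) = 1`, where `a` stands for
`α⁻¹`. -/
noncomputable def shot (a b : LInf) : L2 :=
  Ring.inverse (1 - iteratedVolterra a b) (volterra (mulOp a one))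

theorem shot_eq (a b : LInf) :
    shot a b = volterra (mulOp a (one + volterra (mulOp b (shot a b)))) := by
  have h : (1 - iteratedVolterra a b) (shot a b) = volterra (mulOp a one) :=
    DFunLike.congr_fun (Ring.mul_inverse_cancel _ (isUnit_one_sub_iteratedVolterra a b)) _
  rw [map_add, map_add, ← h]
  exact (sub_add_cancel (shot a b) (iteratedVolterra a b (shot a b))).symm

/-- The value at `1` of `shot`. -/
noncomputable def shotEnd (a b : LInf) : ℂ :=
  integralL (mulOp a (one + volterra (mulOp b (shot a b))))

/-- The solution operator for `-(α u')' + β u = f`, `u(0) = (α u')(0) = 0`, up to sign. -/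
noncomputable def particular (a b : LInf) : L2 →L[ℂ] L2 :=
  Ring.inverse (1 - iteratedVolterra a b) ∘L volterra ∘L mulOp a ∘L volterra

/-- The value at `1` of `particular`. -/
noncomputable def particularEnd (a b : LInf) : L2 →L[ℂ] ℂ :=
  integralL ∘L mulOp a ∘L volterra ∘L (mulOp b ∘L particular a b + 1)

/-- By linearity the equation is `(1 - K) u = c • V a 1 - V a V g` with `K = iteratedVolterra a b`,
and `1 - K` is invertible. -/
theorem volterra_system_iff (a b : LInf) (c : ℂ) (u g : L2) :
    u = volterra (mulOp a (c • one + volterra (mulOp b u - g))) ↔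
      u = c • shot a b - particular a b g := by
  have hu := isUnit_one_sub_iteratedVolterra a b
  have e : volterra (mulOp a (c • one + volterra (mulOp b u - g))) =
      iteratedVolterra a b u +
        (c • volterra (mulOp a one) - volterra (mulOp a (volterra g))) := by
    simp only [map_add, map_sub, map_smul, iteratedVolterra, ContinuousLinearMap.comp_apply]
    abel
  have e2 : c • shot a b - particular a b g = Ring.inverse (1 - iteratedVolterra a b)
      (c • volterra (mulOp a one) - volterra (mulOp a (volterra g))) := by
    simp only [map_sub, map_smul, shot, particular, ContinuousLinearMap.comp_apply]
  rw [e, e2]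
  constructor
  · intro h
    have h' : (1 - iteratedVolterra a b) u =
      c • volterra (mulOp a one) - volterra (mulOp a (volterra g)) := sub_eq_iff_eq_add'.2 h
    rw [← h']
    exact (DFunLike.congr_fun (Ring.inverse_mul_cancel _ hu) u).symm
  · intro h
    refine sub_eq_iff_eq_add'.1 ?_
    have := DFunLike.congr_fun (Ring.mul_inverse_cancel _ hu)
      (c • volterra (mulOp a one) - volterra (mulOp a (volterra g)))
    rwa [mul_apply_eq_comp, ← h] at this

theorem integralL_system (a b : LInf) (c : ℂ) (g : L2) :
    integralL (mulOp a (c • one + volterra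
      (mulOp b (c • shot a b - particular a b g) - g))) =
      c * shotEnd a b - particularEnd a b g := by
  simp only [map_add, map_sub, map_smul, shotEnd, particularEnd, ContinuousLinearMap.comp_apply,
    _root_.add_apply, one_apply_eq_self, smul_eq_mul]
  ring

theorem mem_graph_opSL_iff_shot {a a' b : LInf} (h1 : mulOp a ∘L mulOp a' = 1)
    (h2 : mulOp a' ∘L mulOp a = 1) {u g : L2} :
    (u, g) ∈ (opSL a b).graph ↔ ∃ c : ℂ, u = c • shot a' b - particular a' b g ∧
      c * shotEnd a' b = particularEnd a' b g := by
  rw [mem_graph_opSL_iff h1 h2]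
  refine exists_congr fun c => ?_
  rw [volterra_system_iff]
  refine and_congr_right fun h => ?_
  rw [h, integralL_system, sub_eq_zero]

theorem ContinuouslyInvertible.injective {T : L2 →ₗ.[ℂ] L2} (h : ContinuouslyInvertible T) :
    Function.Injective T := by
  obtain ⟨B, -, hB⟩ := h
  intro u v huv
  exact Subtype.ext (by rw [← hB u, ← hB v, huv])

theorem one_ne_zero_L2 : one ≠ 0 := by
  intro h
  have h1 : integralL one = 1 := by
    rw [integralL_eq, integral_congr_ae one_coeFn]
    simp
  rw [h, map_zero] at h1
  exact zero_ne_one h1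

/-- If `shotEnd = 0`, then `shot` (with `c = 1`, `g = 0`) lies in the kernel. It is not zero:
otherwise `shot_eq` would force `volterra (mulOp a' one) = 0`, hence `one = 0`. -/
theorem shotEnd_ne_zero_of_injective {a a' b : LInf} (h1 : mulOp a ∘L mulOp a' = 1)
    (h2 : mulOp a' ∘L mulOp a = 1) (h : Function.Injective (opSL a b)) : shotEnd a' b ≠ 0 := by
  intro h0
  have hg : (shot a' b, 0) ∈ (opSL a b).graph :=
    (mem_graph_opSL_iff_shot h1 h2).2 ⟨1, by simp, by simp [h0]⟩
  obtain ⟨y, hy, hy0⟩ := (LinearPMap.mem_graph_iff _).1 hg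
  have hs : shot a' b = 0 := by
    rw [← show (y : L2) = shot a' b from hy, h (a₂ := 0) (hy0.trans (map_zero _).symm)]
    rfl
  have e := shot_eq a' b
  rw [hs, map_zero, map_zero, add_zero] at e
  have e1 : mulOp a' one = 0 := eq_zero_of_volterra_eq_zero e.symm
  have e2 : mulOp a (mulOp a' one) = one := DFunLike.congr_fun h1 one
  exact one_ne_zero_L2 (by rw [← e2, e1, map_zero])

theorem continuouslyInvertible_of_shotEnd_ne_zero {a a' b : LInf}
    (h1 : mulOp a ∘L mulOp a' = 1) (h2 : mulOp a' ∘L mulOp a = 1) (h : shotEnd a' b ≠ 0) :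
    ContinuouslyInvertible (opSL a b) := by
  -- The inverse is `c • shot - particular g`, with `c` solved from the scalar equation at `1`.
  refine ⟨((shotEnd a' b)⁻¹ • particularEnd a' b).smulRight (shot a' b) - particular a' b,
    fun g => ?_, fun u => ?_⟩
  · have hg : ((((shotEnd a' b)⁻¹ • particularEnd a' b).smulRight (shot a' b)
        - particular a' b) g, g) ∈ (opSL a b).graph :=
      (mem_graph_opSL_iff_shot h1 h2).2
        ⟨(shotEnd a' b)⁻¹ * particularEnd a' b g, rfl, by field_simp⟩
    obtain ⟨y, hy, hy0⟩ := (LinearPMap.mem_graph_iff _).1 hg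
    simp only at hy hy0
    rw [← hy]
    exact ⟨y.2, hy0⟩
  · obtain ⟨c, hc, hc'⟩ := (mem_graph_opSL_iff_shot h1 h2).1 ((opSL a b).mem_graph u)
    rw [hc]
    simp only [_root_.sub_apply, ContinuousLinearMap.smulRight_apply,
      _root_.smul_apply, ← hc', smul_eq_mul]
    rw [mul_comm c, inv_mul_cancel_left₀ h]

/-! ### Piecewise constant coefficients -/

theorem pwFun_of_mem {r : ℕ} (a : Fin (r + 1) → ℂ) (j : Fin (r + 1)) {x : ℝ}
    (hx : x ∈ Ioc ((j : ℕ) * (1 / ((r : ℝ) + 1))) (((j : ℕ) + 1) * (1 / ((r : ℝ) + 1)))) :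
    pwFun r a x = a j := by
  have hh : (0 : ℝ) ≤ 1 / ((r : ℝ) + 1) := by positivity
  rw [pwFun, Finset.sum_eq_single j, indicator_of_mem hx]
  · intro i _ hij
    refine indicator_of_notMem (fun hi => hij (Fin.ext ?_)) _
    have e1 : ((i : ℕ) : ℝ) < (j : ℕ) + 1 := lt_of_mul_lt_mul_right (hi.1.trans_le hx.2) hh
    have e2 : ((j : ℕ) : ℝ) < (i : ℕ) + 1 := lt_of_mul_lt_mul_right (hx.1.trans_le hi.2) hh
    norm_cast at e1 e2
    omega
  · simp

theorem exists_mem_slab (r : ℕ) {x : ℝ} (hx : x ∈ Ioo (0 : ℝ) 1) : ∃ j : Fin (r + 1),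
    x ∈ Ioc ((j : ℕ) * (1 / ((r : ℝ) + 1))) (((j : ℕ) + 1) * (1 / ((r : ℝ) + 1))) := by
  have hr : (0 : ℝ) < (r : ℝ) + 1 := by positivity
  -- The slabs are open on the left and closed on the right, so the index is `⌈x (r + 1)⌉ - 1`.
  have hpos : 0 < x * (r + 1) := mul_pos hx.1 hr
  have h0 : 0 < ⌈x * (r + 1)⌉₊ := Nat.ceil_pos.2 hpos
  have h1 : ⌈x * (r + 1)⌉₊ ≤ r + 1 := Nat.ceil_le.2 (by push_cast; nlinarith [hx.2])
  have h2 := Nat.ceil_lt_add_one hpos.le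
  have h3 := Nat.le_ceil (x * (r + 1))
  obtain ⟨k, hk⟩ := Nat.exists_eq_succ_of_ne_zero h0.ne'
  rw [hk] at h1 h2 h3
  push_cast at h2 h3
  refine ⟨⟨k, by omega⟩, ?_, ?_⟩
  · rw [mul_one_div, div_lt_iff₀ hr]
    linarith
  · rw [mul_one_div, le_div_iff₀ hr]
    exact h3

theorem pw_coeFn (r : ℕ) (a : Fin (r + 1) → ℂ) : pw r a =ᵐ[mu] pwFun r a := MemLp.coeFn_toLp _

theorem mulOp_pw_coeFn (r : ℕ) (a : Fin (r + 1) → ℂ) (f : L2) :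
    mulOp (pw r a) f =ᵐ[mu] fun x => pwFun r a x * f x := by
  filter_upwards [mulOp_coeFn (pw r a) f, pw_coeFn r a] with x h1 h2
  rw [h1, h2]

theorem mulOp_pw_comp_eq_one {r : ℕ} {a b : Fin (r + 1) → ℂ} (h : ∀ j, a j * b j = 1) :
    mulOp (pw r a) ∘L mulOp (pw r b) = 1 := by
  refine ContinuousLinearMap.ext fun f => Lp.ext ?_
  filter_upwards [mulOp_pw_coeFn r a (mulOp (pw r b) f), mulOp_pw_coeFn r b f,
    ae_restrict_mem measurableSet_Ioo] with x h1 h2 hx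
  obtain ⟨j, hj⟩ := exists_mem_slab r hx
  rw [ContinuousLinearMap.comp_apply, h1, h2, pwFun_of_mem a j hj, pwFun_of_mem b j hj, ← mul_assoc,
    h, one_mul, one_apply_eq_self]

theorem slab_end_le_one {r : ℕ} (j : Fin (r + 1)) :
    (((j : ℕ) : ℝ) + 1) * (1 / ((r : ℝ) + 1)) ≤ 1 := by
  have hr : (0 : ℝ) < (r : ℝ) + 1 := by positivity
  have hj : ((j : ℕ) : ℝ) ≤ r := by exact_mod_cast Nat.lt_succ_iff.1 j.2
  rw [mul_one_div, div_le_one hr]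
  linarith

/-- On a closed slab the coefficient may be replaced by the constant `a j` under the integral, so
the primitive is that of a continuous function, up to both endpoints. -/
theorem hasDerivWithinAt_prim_mulOp_pw {r : ℕ} (a : Fin (r + 1) → ℂ) {f : L2} {F : ℝ → ℂ}
    (hF : Continuous F) (hf : f =ᵐ[mu] F) (j : Fin (r + 1)) {x : ℝ}
    (hx : x ∈ Icc 0 (1 / ((r : ℝ) + 1))) :
    HasDerivWithinAt (fun x => prim (mulOp (pw r a) f) ((j : ℕ) * (1 / ((r : ℝ) + 1)) + x))
      (a j * F ((j : ℕ) * (1 / ((r : ℝ) + 1)) + x)) (Icc 0 (1 / ((r : ℝ) + 1))) x := by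
  set h : ℝ := 1 / ((r : ℝ) + 1) with hh
  have hh0 : 0 < h := by positivity
  have key : ∀ y ∈ Icc 0 h, prim (mulOp (pw r a) f) ((j : ℕ) * h + y) =
      prim (mulOp (pw r a) f) ((j : ℕ) * h) +
        ∫ t in ((j : ℕ) * h)..((j : ℕ) * h + y), a j * F t := fun y hy => by
    have hle : ((j : ℕ) : ℝ) * h ≤ (j : ℕ) * h + y := by linarith [hy.1]
    have hle1 : ((j : ℕ) : ℝ) * h + y ≤ ((j : ℕ) + 1) * h := by linarith [hy.2]
    rw [← sub_eq_iff_eq_add', prim_sub_prim, ← intervalIntegral_mu _ (by positivity) hle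
      (hle1.trans (slab_end_le_one j))]
    refine intervalIntegral.integral_congr_ae ?_
    filter_upwards [mulOp_pw_coeFn r a f, hf] with t h1 h2 ht
    rw [uIoc_of_le hle] at ht
    rw [h1, h2, pwFun_of_mem a j ⟨ht.1, ht.2.trans hle1⟩]
  have hd := ((continuous_const.mul hF : Continuous fun t => a j * F t).integral_hasStrictDerivAt
    ((j : ℕ) * h) ((j : ℕ) * h + x)).hasDerivAt.comp_const_add ((j : ℕ) * h) x
  exact (hd.const_add (prim (mulOp (pw r a) f) ((j : ℕ) * h))).hasDerivWithinAt.congr key (key x hx)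

/-! ### The characteristic function -/

/-- The continuous representatives of `u` and `α u'` for `u = shot` at the point `x`. -/
noncomputable def shotState (r : ℕ) (α β : Fin (r + 1) → ℂ) (x : ℝ) : Fin 2 → ℂ :=
  ![prim (mulOp (pw r α⁻¹) (one + volterra (mulOp (pw r β) (shot (pw r α⁻¹) (pw r β))))) x,
    1 + prim (mulOp (pw r β) (shot (pw r α⁻¹) (pw r β))) x]

theorem shotState_zero (r : ℕ) (α β : Fin (r + 1) → ℂ) : shotState r α β 0 = ![0, 1] := by
  rw [shotState, prim_of_nonpos _ le_rfl, prim_of_nonpos _ le_rfl, add_zero]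

/-- Conjugation by `diag(1, α_j)` passes from the coordinates `(u, u')` to `(u, α u')`, which match
at the interfaces. -/
theorem slabMatrixTilde_mulVec (r : ℕ) (α β : Fin (r + 1) → ℂ) (j : Fin (r + 1))
    (y : Fin 2 → ℂ) :
    slabMatrixTilde r α β j *ᵥ y = ![(slabMatrix r α β j *ᵥ ![y 0, (α j)⁻¹ * y 1]) 0,
      α j * (slabMatrix r α β j *ᵥ ![y 0, (α j)⁻¹ * y 1]) 1] := by
  have hdiag : ∀ (c : ℂ) (y : Fin 2 → ℂ), !![1, 0; 0, c] *ᵥ y = ![y 0, c * y 1] := fun c y => by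
    ext i
    fin_cases i <;> simp [Matrix.mulVec, dotProduct, Fin.sum_univ_two]
  rw [slabMatrixTilde, ← Matrix.mulVec_mulVec, ← Matrix.mulVec_mulVec, hdiag (α j)⁻¹, hdiag]

theorem slabMatrix_mulVec_shotState {r : ℕ} (α β : Fin (r + 1) → ℂ) (j : Fin (r + 1)) :
    slabMatrix r α β j *ᵥ ![shotState r α β ((j : ℕ) * (1 / ((r : ℝ) + 1))) 0,
        (α j)⁻¹ * shotState r α β ((j : ℕ) * (1 / ((r : ℝ) + 1))) 1] =
      ![shotState r α β (((j : ℕ) + 1) * (1 / ((r : ℝ) + 1))) 0,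
        (α j)⁻¹ * shotState r α β (((j : ℕ) + 1) * (1 / ((r : ℝ) + 1))) 1] := by
  set h : ℝ := 1 / ((r : ℝ) + 1) with hh
  have hh0 : 0 < h := by positivity
  have hc : ∀ i, Continuous fun x => shotState r α β x i := fun i => by
    fin_cases i
    · exact continuous_prim _
    · exact continuous_const.add (continuous_prim _)
  have hu : shot (pw r α⁻¹) (pw r β) =ᵐ[mu] fun x => shotState r α β x 0 := by
    have := volterra_coeFn
      (mulOp (pw r α⁻¹) (one + volterra (mulOp (pw r β) (shot (pw r α⁻¹) (pw r β)))))
    rwa [← shot_eq] at this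
  have hw : (one + volterra (mulOp (pw r β) (shot (pw r α⁻¹) (pw r β))) : L2) =ᵐ[mu]
      fun x => shotState r α β x 1 := by
    filter_upwards [Lp.coeFn_add one (volterra (mulOp (pw r β) (shot (pw r α⁻¹) (pw r β)))),
      one_coeFn, volterra_coeFn (mulOp (pw r β) (shot (pw r α⁻¹) (pw r β)))] with x e1 e2 e3
    rw [e1, Pi.add_apply, e2, e3]
    rfl
  -- Inside slab `j`, `u' = α_j⁻¹ w` and `(α_j⁻¹ w)' = (β_j / α_j) u`, where `w` is the second
  -- component of the state.
  have hs : IsSolution h (β j / α j) (fun x => shotState r α β ((j : ℕ) * h + x) 0)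
      (fun x => (α j)⁻¹ * shotState r α β ((j : ℕ) * h + x) 1) := fun x hx => by
    refine ⟨hasDerivWithinAt_prim_mulOp_pw α⁻¹ (hc 1) hw j hx, ?_⟩
    have := ((hasDerivWithinAt_prim_mulOp_pw β (hc 0) hu j hx).const_add 1).const_mul (α j)⁻¹
    rw [← mul_assoc, ← div_eq_inv_mul] at this
    exact this
  have := transitionMatrix_spec hh0 (β j / α j) _ _ hs
  simp only [add_zero] at this
  rw [add_one_mul]
  exact this

theorem slabMatrixTilde_mulVec_shotState {r : ℕ} {α : Fin (r + 1) → ℂ} (β : Fin (r + 1) → ℂ)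
    (hα : ∀ j, α j ≠ 0) (j : Fin (r + 1)) :
    slabMatrixTilde r α β j *ᵥ shotState r α β ((j : ℕ) * (1 / ((r : ℝ) + 1))) =
      shotState r α β (((j : ℕ) + 1) * (1 / ((r : ℝ) + 1))) := by
  rw [slabMatrixTilde_mulVec, slabMatrix_mulVec_shotState]
  ext i
  fin_cases i <;> simp [hα]

theorem prod_slabMatrixTilde_mulVec {r : ℕ} {α : Fin (r + 1) → ℂ} (β : Fin (r + 1) → ℂ)
    (hα : ∀ j, α j ≠ 0) (m : ℕ) (hm : m ≤ r) :
    (List.ofFn fun k : Fin m => slabMatrixTilde r α β ⟨m - (k : ℕ), by omega⟩).prod *ᵥ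
      shotState r α β (1 * (1 / ((r : ℝ) + 1))) =
        shotState r α β (((m : ℝ) + 1) * (1 / ((r : ℝ) + 1))) := by
  induction m with
  | zero => simp
  | succ m ih =>
    have ih' := ih (by omega)
    -- The list begins with the rightmost slab, so removing its head leaves the product for `m`.
    rw [List.ofFn_succ, List.prod_cons, ← Matrix.mulVec_mulVec]
    simp only [Fin.val_succ, Nat.add_sub_add_right, Fin.val_zero, Nat.sub_zero]
    rw [ih']
    have := slabMatrixTilde_mulVec_shotState β hα ⟨m + 1, by omega⟩
    push_cast at this ⊢
    exact this

theorem characteristicFun_eq {r : ℕ} (hr : 1 ≤ r) {α : Fin (r + 1) → ℂ} (β : Fin (r + 1) → ℂ)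
    (hα : ∀ j, α j ≠ 0) :
    characteristicFun r α β = α 0 * shotEnd (pw r α⁻¹) (pw r β) := by
  have e0 := slabMatrixTilde_mulVec_shotState β hα 0
  -- The characteristic function starts from `u'(0) = 1`, while `shot` starts from `(α u')(0) = 1`;
  -- this is the source of the factor `α 0`.
  have e1 : ![slabMatrix r α β 0 0 1, α 0 * slabMatrix r α β 0 1 1] =
      α 0 • shotState r α β (1 * (1 / ((r : ℝ) + 1))) := by
    simp only [Fin.val_zero, Nat.cast_zero, zero_mul, zero_add, shotState_zero] at e0
    rw [← e0, slabMatrixTilde_mulVec]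
    ext i
    have := hα 0
    fin_cases i <;> simp [Matrix.mulVec, dotProduct, Fin.sum_univ_two] <;> field_simp <;> simp
  -- On the last slab only the first component is needed: it gives `u(1)`, which is `shotEnd`.
  have e2 := congrFun (slabMatrix_mulVec_shotState α β (Fin.last r)) 0
  have hcast : (((r - 1 : ℕ) : ℝ) + 1) = r := by
    rw [Nat.cast_sub hr]; simp
  have hr1 : ((r : ℝ) + 1) * (1 / ((r : ℝ) + 1)) = 1 := by
    field_simp
  rw [characteristicFun, e1, Matrix.mulVec_smul,
    prod_slabMatrixTilde_mulVec β hα (r - 1) (by omega), hcast]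
  rw [Fin.val_last, hr1] at e2
  simp only [Matrix.mulVec, dotProduct, Fin.sum_univ_two, Matrix.cons_val_zero,
    Matrix.cons_val_one] at e2
  rw [shotEnd, integralL_apply]
  change _ = α 0 * shotState r α β 1 0
  rw [← e2]
  simp only [dotProduct, Fin.sum_univ_two, Matrix.cons_val_zero, Matrix.cons_val_one, Pi.smul_apply,
    smul_eq_mul]
  ring

end IndefSL

theorem mainTheorem5 (r : ℕ) (hr : 1 ≤ r) (α β : Fin (r + 1) → ℂ) (hα : ∀ j, α j ≠ 0)
    (hm : IndefSL.mean (fun x => (IndefSL.pwFun r α x)⁻¹) ≠ 0) :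
    List.TFAE [
      IndefSL.ContinuouslyInvertible (IndefSL.opSL (IndefSL.pw r α) (IndefSL.pw r β)),
      Function.Injective (IndefSL.opSL (IndefSL.pw r α) (IndefSL.pw r β)),
      IndefSL.characteristicFun r α β ≠ 0] := by
  have h1 := IndefSL.mulOp_pw_comp_eq_one (a := α) (b := α⁻¹) fun j => mul_inv_cancel₀ (hα j)
  have h2 := IndefSL.mulOp_pw_comp_eq_one (a := α⁻¹) (b := α) fun j => inv_mul_cancel₀ (hα j)
  rw [IndefSL.characteristicFun_eq hr β hα]
  tfae_have 1 → 2 := IndefSL.ContinuouslyInvertible.injective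
  tfae_have 2 → 3 := fun h => mul_ne_zero (hα 0) (IndefSL.shotEnd_ne_zero_of_injective h1 h2 h)
  tfae_have 3 → 1 := fun h =>
    IndefSL.continuouslyInvertible_of_shotEnd_ne_zero h1 h2 (right_ne_zero_of_mul h)
  tfae_finish
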